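/- A family $\mathcal G$ of finite simple graphs has an $f(n)$-bit adjacency labelling scheme if there is a function $A:\{0,1\}^*\times\{0,1\}^*\to\{0,1\}$ such that for every $n\ge 0$ and every $n$-vertex graph $G\in\mathcal G$ there is a labelling $\ell:V(G)\to\{0,1\}^*$ with $|\ell(v)|\le f(n)$ for every vertex $v$, and such that for all vertices $v,w$ of $G$ one has $A(\ell(v),\ell(w))=1$ if $vw\in E(G)$ and $A(\ell(v),\ell(w))=0$ otherwise. The strong product $P_1\boxtimes P_2$ of two graphs has vertex set $V(P_1)\times V(P_2)$, and two distinct vertices $(x,y)$ and $(x',y')$ are adjacent if and only if ($x=x'$ or $xx'\in E(P_1)$) and ($y=y'$ or $yy'\in E(P_2)$). **Theorem.** The family of all graphs that are isomorphic to a (not necessarily induced) subgraph of a strong product $P_1\boxtimes P_2$ of two finite paths $P_1,P_2$ has a $(1+o(1))\log_2 n$-bit adjacency labelling scheme. More precisely, there is a function $f:\mathbb N\to\mathbb R$ with $$f(n)=\log_2 n+O\!\left(\sqrt{\log_2 n\,\log_2\log_2 n}\right)\qquad(n\to\infty),$$ so that in particular $f(n)=(1+o(1))\log_2 n$, such that this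 family has an $f(n)$-bit adjacency labelling scheme. -/

import Mathlib

open Filter Asymptotics

universe u v

/-- The strong product of two graphs: distinct vertices `(a, b)` and `(a', b')` are adjacent iff
`a = a'` or `a` is adjacent to `a'`, and `b = b'` or `b` is adjacent to `b'`. -/
def SimpleGraph.strongProduct {α : Type u} {β : Type v} (G : SimpleGraph α) (H : SimpleGraph β) :
    SimpleGraph (α × β) where
  Adj x y := x ≠ y ∧ (x.1 = y.1 ∨ G.Adj x.1 y.1) ∧ (x.2 = y.2 ∨ H.Adj x.2 y.2)
  symm := ⟨fun _ _ h => ⟨h.1.symm, h.2.1.imp Eq.symm (fun k => k.symm),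
    h.2.2.imp Eq.symm (fun k => k.symm)⟩⟩
  loopless := ⟨fun _ h => h.1 rfl⟩

/-- A family of (finite, simple) graphs, as a predicate on graphs. -/
abbrev GraphFamily : Type (u + 1) := ∀ V : Type u, SimpleGraph V → Prop

/-- The family `𝓕` has an `f(n)`-bit adjacency labelling scheme: there is one adjacency tester `A`
on pairs of bitstrings such that the vertices of each `n`-vertex graph of the family can be
labelled by bitstrings of length at most `f n`, in such a way that `A`, given the labels of any
two vertices, tells whether they are adjacent. -/
def HasAdjacencyLabellingScheme (𝓕 : GraphFamily.{u}) (f : ℕ → ℝ) : Prop :=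
  ∃ A : List Bool → List Bool → Bool,
    ∀ (V : Type u) [Fintype V] (G : SimpleGraph V), 𝓕 V G →
      ∃ ℓ : V → List Bool,
        (∀ v, ((ℓ v).length : ℝ) ≤ f (Fintype.card V)) ∧
        ∀ v w, A (ℓ v) (ℓ w) = true ↔ G.Adj v w

/-- The graphs that are (isomorphic to) subgraphs, not necessarily induced, of the strong product
of two finite paths. -/
def SubgraphOfStrongProductOfPaths : GraphFamily.{u} := fun _ G =>
  ∃ m h : ℕ, G.IsContained
    ((SimpleGraph.pathGraph m).strongProduct (SimpleGraph.pathGraph h))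

/-! Compress coordinates to be below `n`, and take `k` refinements of the grid with cells of side `B
^ (i + 1)`, level `i` being shifted by `i`. A point is coded by the rank of each cell among those
meeting its successor. Ranking by decreasing weight makes the rank product telescope to at most `n *
4 ^ k` (`exists_rank_code`), as a cell meets at most 4 cells of the next level. A Rankin-type bound
(`card_boundedProducts_le`) then leaves about `log n + O(k log log n)` bits per code.

The shifts are distinct mod `B`, so a unit step crosses a boundary on at most one level per
coordinate, and neighbouring codes differ in at most four entries. Storing such a patch for each of
the nine directions that carries an edge costs `O(log B)` bits (`exists_gridLabel`). With `m` about
`log n`, `log B` about `sqrt (m log m)` and `k` about `m / log B`, both overheads are `O(sqrt (m log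
m))`. -/

/-! ### Rank codes along non-nested partitions -/

/-- Ranking a finite set by decreasing weight. -/
theorem exists_injOn_mul_le_sum {κ : Type*} (s : Finset κ) (w : κ → ℕ) :
    ∃ r : κ → ℕ, Set.InjOn r s ∧
      ∀ q ∈ s, 0 < r q ∧ r q ≤ s.card ∧ r q * w q ≤ ∑ q' ∈ s, w q' := by
  classical
  -- The inserted element has least weight, so it takes the last rank and earlier ranks stay.
  induction s using Finset.induction_on_min_value w with
  | empty => exact ⟨fun _ => 0, by simp, by simp⟩
  | insert a s ha hmin ih =>
    obtain ⟨r, hinj, hr⟩ := ih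
    have hne : ∀ q ∈ s, q ≠ a := fun q hq h => ha (h ▸ hq)
    refine ⟨Function.update r a (s.card + 1), ?_, ?_⟩
    · rw [Finset.coe_insert, Set.injOn_insert (by simpa using ha)]
      refine ⟨fun x hx y hy hxy => ?_, ?_⟩
      · rw [Function.update_of_ne (hne x hx), Function.update_of_ne (hne y hy)] at hxy
        exact hinj hx hy hxy
      · rintro ⟨x, hx, hxa⟩
        rw [Function.update_of_ne (hne x hx), Function.update_self] at hxa
        have := (hr x hx).2.1
        omega
    · intro q hq
      rw [Finset.card_insert_of_notMem ha, Finset.sum_insert ha]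
      rcases Finset.mem_insert.1 hq with rfl | hq
      · rw [Function.update_self]
        refine ⟨by omega, le_rfl, ?_⟩
        have := Finset.card_nsmul_le_sum s w (w q) hmin
        rw [smul_eq_mul] at this
        linarith
      · rw [Function.update_of_ne (hne q hq)]
        obtain ⟨h1, h2, h3⟩ := hr q hq
        exact ⟨h1, by omega, by omega⟩

/-- If each of the partitions of `V` given by the maps `c 0, …, c k` is refined in a controlled way
by the preceding one (without being nested), then the class `c 0 p` of a point is described by the
ranks of the `c i p` relative to the `c (i + 1) p`, and the product of these ranks is small. -/
theorem exists_rank_code {V κ : Type*} [Fintype V] [DecidableEq κ] (k D M : ℕ)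
    (c : ℕ → V → κ)
    (hD : ∀ i < k, ∀ q, ((Finset.univ.filter (c i · = q)).image (c (i + 1))).card ≤ D)
    (hM : ∀ i < k, ∀ q, ((Finset.univ.filter (c (i + 1) · = q)).image (c i)).card ≤ M)
    (htop : ∀ p q, c k p = c k q) :
    ∃ r : ℕ → κ → κ → ℕ,
      (∀ i < k, ∀ p, 0 < r i (c (i + 1) p) (c i p) ∧ r i (c (i + 1) p) (c i p) ≤ M) ∧
      (∀ p q, (∀ i < k, r i (c (i + 1) p) (c i p) = r i (c (i + 1) q) (c i q)) →
        c 0 p = c 0 q) ∧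
      ∀ p, ∏ i ∈ Finset.range k, r i (c (i + 1) p) (c i p) ≤ Fintype.card V * D ^ k := by
  let C : ℕ → κ → Finset κ := fun i q => (Finset.univ.filter (c (i + 1) · = q)).image (c i)
  let w : ℕ → κ → ℕ := fun i =>
    Nat.rec (fun _ => 1) (fun i w q => ∑ q' ∈ C i q, w q') i
  have hw : ∀ i q, w (i + 1) q = ∑ q' ∈ C i q, w i q' := fun _ _ => rfl
  have hC : ∀ i p, c i p ∈ C i (c (i + 1) p) := fun i p =>
    Finset.mem_image.2 ⟨p, by simp, rfl⟩
  choose r hinj hr using fun i q => exists_injOn_mul_le_sum (C i q) (w i)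
  have htotal : ∀ j ≤ k, ∑ q ∈ Finset.univ.image (c j), w j q ≤ Fintype.card V * D ^ j := by
    intro j
    induction j with
    | zero =>
      intro _
      simpa [w] using (Finset.card_image_le (s := Finset.univ) (f := c 0))
    | succ j ih =>
      intro hj
      -- Double counting: a class of level `j` contributes once for each class of level `j + 1` that
      -- it meets, at most `D` times.
      have hswap : ∑ q ∈ Finset.univ.image (c (j + 1)), w (j + 1) q =
          ∑ q' ∈ Finset.univ.image (c j),
            ∑ _q ∈ (Finset.univ.filter (c j · = q')).image (c (j + 1)), w j q' := by
        simp only [hw]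
        apply Finset.sum_comm'
        intro x y
        simp only [C, Finset.mem_image, Finset.mem_univ, true_and, Finset.mem_filter]
        constructor
        · rintro ⟨-, p, h1, h2⟩
          exact ⟨⟨p, h2, h1⟩, p, h2⟩
        · rintro ⟨⟨p, h1, h2⟩, -⟩
          exact ⟨⟨p, h2⟩, p, h2, h1⟩
      rw [hswap]
      calc _ ≤ ∑ q' ∈ Finset.univ.image (c j), w j q' * D := by
            refine Finset.sum_le_sum fun q' _ => ?_
            rw [Finset.sum_const, smul_eq_mul, mul_comm]
            exact Nat.mul_le_mul_left _ (hD j hj q')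
        _ ≤ _ := by
            rw [← Finset.sum_mul, pow_succ, ← mul_assoc]
            exact Nat.mul_le_mul_right _ (ih (by omega))
  refine ⟨r, fun i hi p => ?_, fun p q h => ?_, fun p => ?_⟩
  · obtain ⟨h1, h2, -⟩ := hr i _ _ (hC i p)
    exact ⟨h1, h2.trans (hM i hi _)⟩
  · have : ∀ j ≤ k, c (k - j) p = c (k - j) q := by
      intro j
      induction j with
      | zero => intro _; exact htop p q
      | succ j ih =>
        intro hj
        have h1 := ih (by omega)
        have h2 := h (k - (j + 1)) (by omega)
        have h3 := hC (k - (j + 1)) p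
        have h4 := hC (k - (j + 1)) q
        rw [show k - (j + 1) + 1 = k - j by omega] at h2 h3 h4
        rw [h1] at h2 h3
        exact hinj _ _ h3 h4 h2
    simpa using this k le_rfl
  · have hprod : ∀ j, ∏ i ∈ Finset.range j, r i (c (i + 1) p) (c i p) ≤ w j (c j p) := by
      intro j
      induction j with
      | zero => simp [w]
      | succ j ih =>
        rw [Finset.prod_range_succ, mul_comm]
        exact (Nat.mul_le_mul_left _ ih).trans (hr j _ _ (hC j p)).2.2
    refine (hprod k).trans (le_trans ?_ (htotal k le_rfl))
    exact Finset.single_le_sum (f := w k) (fun _ _ => Nat.zero_le _)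
      (Finset.mem_image_of_mem _ (Finset.mem_univ p))

/-! ### Counting sequences of bounded product -/

/-- Positive integer sequences of length `k` whose product is at most `X`. -/
def boundedProducts (k X : ℕ) : Finset (Fin k → ℕ) :=
  (Fintype.piFinset fun _ => Finset.Icc 1 X).filter fun a => ∏ i, a i ≤ X

theorem mem_boundedProducts {k X : ℕ} {a : Fin k → ℕ} (hpos : ∀ i, 0 < a i)
    (h : ∏ i, a i ≤ X) : a ∈ boundedProducts k X := by
  rw [boundedProducts, Finset.mem_filter, Fintype.mem_piFinset]
  refine ⟨fun i => Finset.mem_Icc.2 ⟨hpos i, le_trans ?_ h⟩, h⟩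
  exact Finset.single_le_prod' (f := a) (fun j _ => hpos j) (Finset.mem_univ i)

/-- Each counted sequence satisfies `1 ≤ X / ∏ a i`; summing this over the whole box factorises into
a power of a harmonic number. -/
theorem card_boundedProducts_le (k X : ℕ) :
    ((boundedProducts k X).card : ℝ) ≤ X * (harmonic X : ℝ) ^ k := by
  have hH : ((harmonic X : ℚ) : ℝ) = ∑ a ∈ Finset.Icc 1 X, ((a : ℝ))⁻¹ := by
    rw [harmonic_eq_sum_Icc]; push_cast; rfl
  have hpow : (harmonic X : ℝ) ^ k =
      ∑ a ∈ Fintype.piFinset fun _ : Fin k => Finset.Icc 1 X, ∏ i, ((a i : ℝ))⁻¹ := by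
    rw [← Finset.prod_univ_sum (fun _ : Fin k => Finset.Icc 1 X) fun _ a => ((a : ℝ))⁻¹, hH]
    simp
  rw [hpow, Finset.mul_sum, Finset.cast_card]
  refine le_trans (Finset.sum_le_sum fun a ha => ?_)
    (Finset.sum_le_sum_of_subset_of_nonneg (Finset.filter_subset _ _) fun a _ _ => by positivity)
  rw [boundedProducts, Finset.mem_filter, Fintype.mem_piFinset] at ha
  rw [Finset.prod_inv_distrib, ← div_eq_mul_inv, one_le_div]
  · exact_mod_cast ha.2
  · exact Finset.prod_pos fun i _ => by
      exact_mod_cast (Finset.mem_Icc.1 (ha.1 i)).1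

theorem card_boundedProducts_two_pow_le (k e : ℕ) :
    (boundedProducts k (2 ^ e)).card ≤ 2 ^ e * (e + 1) ^ k := by
  have h1 : (harmonic (2 ^ e) : ℝ) ≤ e + 1 := by
    refine (harmonic_le_one_add_log _).trans ?_
    push_cast
    rw [Real.log_pow]
    nlinarith [Real.log_two_lt_d9, (Nat.cast_nonneg e : (0 : ℝ) ≤ e)]
  have h2 : (0 : ℝ) ≤ (harmonic (2 ^ e) : ℝ) := by
    exact_mod_cast (harmonic_pos (n := 2 ^ e) (by positivity)).le
  have h3 := (card_boundedProducts_le k (2 ^ e)).trans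
    (mul_le_mul_of_nonneg_left (pow_le_pow_left₀ h2 h1 k) (by positivity))
  exact_mod_cast h3

/-! ### Shifted grids -/

/-- The index of the interval of length `B ^ (i + 1)` that contains `x`, in the partition of the
line shifted by `i`. -/
def shiftedCell (B i x : ℕ) : ℕ := (x + i) / B ^ (i + 1)

theorem shiftedCell_succ_eq (B i x : ℕ) :
    shiftedCell B (i + 1) x = (x + i + 1) / B ^ (i + 1) / B := by
  rw [shiftedCell, Nat.div_div_eq_div_mul, ← pow_succ]
  rfl

theorem div_eq_or_succ_div_eq (a b : ℕ) : (a + 1) / b = a / b ∨ (a + 1) / b = a / b + 1 := by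
  rw [Nat.succ_div]; split_ifs <;> simp

theorem shiftedCell_succ_mem (B i x : ℕ) :
    shiftedCell B (i + 1) x ∈
      ({shiftedCell B i x / B, (shiftedCell B i x + 1) / B} : Finset ℕ) := by
  rw [shiftedCell_succ_eq, Finset.mem_insert, Finset.mem_singleton]
  rcases div_eq_or_succ_div_eq (x + i) (B ^ (i + 1)) with h | h <;> rw [h] <;> simp [shiftedCell]

/-- Moving the shift from `i` to `i + 1` raises the block index by 0 or 1, hence one extra block on
the left of the usual `B`. -/
theorem shiftedCell_mem_Icc {B : ℕ} (hB : 0 < B) (i x : ℕ) :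
    shiftedCell B i x ∈
      Finset.Icc (shiftedCell B (i + 1) x * B - 1) (shiftedCell B (i + 1) x * B + B - 1) := by
  rw [shiftedCell_succ_eq, Finset.mem_Icc]
  have h1 := Nat.div_mul_le_self ((x + i + 1) / B ^ (i + 1)) B
  have h2 := Nat.lt_div_mul_add (a := (x + i + 1) / B ^ (i + 1)) hB
  have h3 : shiftedCell B i x = (x + i) / B ^ (i + 1) := rfl
  rcases div_eq_or_succ_div_eq (x + i) (B ^ (i + 1)) with h | h <;> omega

theorem dvd_of_shiftedCell_ne {B i x : ℕ} (h : shiftedCell B i x ≠ shiftedCell B i (x + 1)) :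
    B ∣ x + i + 1 := by
  by_contra hB
  apply h
  rw [shiftedCell, shiftedCell, add_right_comm, Nat.succ_div, if_neg, add_zero]
  exact fun h' => hB ((dvd_pow_self B (Nat.succ_ne_zero i)).trans h')

/-- A boundary crossed at level `i` fixes `i` modulo `B`, and the levels considered are below `B`.
-/
theorem eq_of_shiftedCell_ne {B i j x y : ℕ} (hi : i < B) (hj : j < B)
    (hxy : x ≤ y + 1) (hyx : y ≤ x + 1)
    (hxi : shiftedCell B i x ≠ shiftedCell B i y) (hxj : shiftedCell B j x ≠ shiftedCell B j y) :
    i = j := by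
  have key : ∀ z, B ∣ z + i + 1 → B ∣ z + j + 1 → i = j := by
    intro z h1 h2
    have h3 : z + 1 + i ≡ z + 1 + j [MOD B] := by
      rw [Nat.ModEq, Nat.mod_eq_zero_of_dvd (by convert h1 using 1; ring),
        Nat.mod_eq_zero_of_dvd (by convert h2 using 1; ring)]
    exact (Nat.ModEq.add_left_cancel' _ h3).eq_of_lt_of_lt hi hj
  obtain rfl | rfl | rfl : x = y ∨ y = x + 1 ∨ x = y + 1 := by omega
  · exact absurd rfl hxi
  · exact key x (dvd_of_shiftedCell_ne hxi) (dvd_of_shiftedCell_ne hxj)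
  · exact key y (dvd_of_shiftedCell_ne hxi.symm) (dvd_of_shiftedCell_ne hxj.symm)

/-- Two integers at distance at most one lie in the same cells, except on at most one level. -/
theorem exists_forall_shiftedCell_ne_imp {B x y : ℕ} (hxy : x ≤ y + 1) (hyx : y ≤ x + 1) :
    ∃ i₀, ∀ i < B, shiftedCell B i x ≠ shiftedCell B i y → i = i₀ := by
  by_cases h : ∃ j < B, shiftedCell B j x ≠ shiftedCell B j y
  · obtain ⟨j, hj, hne⟩ := h
    exact ⟨j, fun i hi hi' => eq_of_shiftedCell_ne hi hj hxy hyx hi' hne⟩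
  · push Not at h
    exact ⟨0, fun i hi hne => absurd (h i hi) hne⟩

/-- The square cells of level `i`. -/
def shiftedSquare (B i : ℕ) (p : ℕ × ℕ) : ℕ × ℕ := (shiftedCell B i p.1, shiftedCell B i p.2)

theorem card_image_shiftedSquare_succ_le {V : Type*} [Fintype V] (pos : V → ℕ × ℕ) (B i : ℕ)
    (q : ℕ × ℕ) :
    ((Finset.univ.filter fun v => shiftedSquare B i (pos v) = q).image
      fun v => shiftedSquare B (i + 1) (pos v)).card ≤ 4 := by
  let s : ℕ → Finset ℕ := fun u => {u / B, (u + 1) / B}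
  have hs : ∀ u, (s u).card ≤ 2 := fun u => Finset.card_le_two
  refine (Finset.card_le_card (t := s q.1 ×ˢ s q.2) ?_).trans ?_
  · intro z hz
    simp only [Finset.mem_image, Finset.mem_filter, Finset.mem_univ, true_and] at hz
    obtain ⟨v, rfl, rfl⟩ := hz
    exact Finset.mem_product.2 ⟨shiftedCell_succ_mem _ _ _, shiftedCell_succ_mem _ _ _⟩
  · rw [Finset.card_product]
    exact Nat.mul_le_mul (hs _) (hs _)

theorem card_image_shiftedSquare_le {V : Type*} [Fintype V] (pos : V → ℕ × ℕ) {B : ℕ} (hB : 0 < B)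
    (i : ℕ) (q : ℕ × ℕ) :
    ((Finset.univ.filter fun v => shiftedSquare B (i + 1) (pos v) = q).image
      fun v => shiftedSquare B i (pos v)).card ≤ (B + 1) * (B + 1) := by
  let s : ℕ → Finset ℕ := fun u => Finset.Icc (u * B - 1) (u * B + B - 1)
  have hs : ∀ u, (s u).card ≤ B + 1 := fun u => by
    simp only [s, Nat.card_Icc]; omega
  refine (Finset.card_le_card (t := s q.1 ×ˢ s q.2) ?_).trans ?_
  · intro z hz
    simp only [Finset.mem_image, Finset.mem_filter, Finset.mem_univ, true_and] at hz
    obtain ⟨v, rfl, rfl⟩ := hz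
    exact Finset.mem_product.2 ⟨shiftedCell_mem_Icc hB _ _, shiftedCell_mem_Icc hB _ _⟩
  · rw [Finset.card_product]
    exact Nat.mul_le_mul (hs _) (hs _)

/-! ### Patches and labels -/

/-- A list of four entries of a sequence together with their new values. -/
abbrev Patch (k M : ℕ) : Type := Fin 4 → Fin k × Fin (M + 1)

/-- The second sequence is obtained from the first by changing entries according to the patch. -/
def Patch.Transforms {k M : ℕ} (π : Patch k M) (a a' : Fin k → ℕ) : Prop :=
  (∀ t, a' (π t).1 = (π t).2) ∧ ∀ i, (∀ t, (π t).1 ≠ i) → a' i = a i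

theorem Patch.Transforms.unique {k M : ℕ} {π : Patch k M} {a a₁ a₂ : Fin k → ℕ}
    (h₁ : π.Transforms a a₁) (h₂ : π.Transforms a a₂) : a₁ = a₂ := by
  funext i
  by_cases h : ∃ t, (π t).1 = i
  · obtain ⟨t, rfl⟩ := h
    rw [h₁.1, h₂.1]
  · push Not at h
    rw [h₁.2 i h, h₂.2 i h]

theorem Patch.exists_transforms {k M : ℕ} {a a' : Fin k → ℕ} (hM : ∀ i, a' i ≤ M)
    (j : Fin 4 → Fin k) (hj : ∀ i, a i ≠ a' i → ∃ t, j t = i) :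
    ∃ π : Patch k M, π.Transforms a a' := by
  refine ⟨fun t => (j t, ⟨a' (j t), Nat.lt_succ_of_le (hM _)⟩), fun t => rfl, fun i hi => ?_⟩
  by_contra h
  obtain ⟨t, ht⟩ := hj i (Ne.symm h)
  exact hi t ht

/-- The label of a vertex: a rank code and the position in the finest cell; moreover, in each
direction in which there is a neighbour, a description of the same data for this neighbour. -/
abbrev GridLabel (k B X : ℕ) : Type :=
  (boundedProducts k X × (Fin B × Fin B)) ×
    (Fin 3 × Fin 3 → Option (Patch k ((B + 1) * (B + 1)) × (Fin B × Fin B)))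

/-- The adjacency tester for labels. -/
def GridLabel.Test {k B X : ℕ} (l l' : GridLabel k B X) : Prop :=
  ∃ d, ∃ π o, l.2 d = some (π, o) ∧ π.Transforms l.1.1 l'.1.1 ∧ o = l'.1.2

theorem exists_gridLabel {V : Type*} [Fintype V] (G : SimpleGraph V) (pos : V → ℕ × ℕ)
    (hinj : Function.Injective pos)
    (hadj : ∀ v w, G.Adj v w → ((pos v).1 ≤ (pos w).1 + 1 ∧ (pos w).1 ≤ (pos v).1 + 1) ∧
      ((pos v).2 ≤ (pos w).2 + 1 ∧ (pos w).2 ≤ (pos v).2 + 1))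
    {k B X : ℕ} (hk : 0 < k) (hkB : k ≤ B) (hX : Fintype.card V * 4 ^ k ≤ X)
    (hpos : ∀ v, (pos v).1 + k < B ^ (k + 1) ∧ (pos v).2 + k < B ^ (k + 1)) :
    ∃ ℓ : V → GridLabel k B X, ∀ v w, (ℓ v).Test (ℓ w) ↔ G.Adj v w := by
  classical
  have hB : 0 < B := hk.trans_le hkB
  have htop : ∀ v, shiftedSquare B k (pos v) = (0, 0) := fun v =>
    Prod.ext (Nat.div_eq_of_lt (hpos v).1) (Nat.div_eq_of_lt (hpos v).2)
  obtain ⟨r, hr, hrinj, hrprod⟩ := exists_rank_code k 4 ((B + 1) * (B + 1))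
    (fun i v => shiftedSquare B i (pos v))
    (fun i _ q => card_image_shiftedSquare_succ_le pos B i q)
    (fun i _ q => card_image_shiftedSquare_le pos hB i q)
    (fun p q => by rw [htop, htop])
  let a : V → Fin k → ℕ := fun v i =>
    r i (shiftedSquare B (i + 1) (pos v)) (shiftedSquare B i (pos v))
  let o : V → Fin B × Fin B := fun v =>
    (⟨(pos v).1 % B, Nat.mod_lt _ hB⟩, ⟨(pos v).2 % B, Nat.mod_lt _ hB⟩)
  have ha : ∀ v, a v ∈ boundedProducts k X := fun v =>
    mem_boundedProducts (fun i => (hr i i.2 v).1) (le_trans (by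
      simpa only [Finset.prod_range] using hrprod v) hX)
  have hao : ∀ v w, a v = a w → o v = o w → v = w := by
    intro v w h1 h2
    have h3 := hrinj v w fun i hi => congrFun h1 ⟨i, hi⟩
    have h4 : ∀ x, shiftedCell B 0 x = x / B := fun x => by simp [shiftedCell]
    simp only [shiftedSquare, h4, Prod.mk.injEq] at h3
    simp only [o, Prod.mk.injEq, Fin.mk.injEq] at h2
    apply hinj
    apply Prod.ext
    · rw [← Nat.div_add_mod (pos v).1 B, h3.1, h2.1, Nat.div_add_mod]
    · rw [← Nat.div_add_mod (pos v).2 B, h3.2, h2.2, Nat.div_add_mod]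
  have hpatch : ∀ v w, G.Adj v w →
      ∃ π : Patch k ((B + 1) * (B + 1)), π.Transforms (a v) (a w) := by
    intro v w hvw
    obtain ⟨h1, h2⟩ := hadj v w hvw
    obtain ⟨i₁, hi₁⟩ := exists_forall_shiftedCell_ne_imp (B := B) h1.1 h1.2
    obtain ⟨i₂, hi₂⟩ := exists_forall_shiftedCell_ne_imp (B := B) h2.1 h2.2
    -- Level `k` is included because the last entry involves it; there all cells coincide, so a
    -- differing level is below `k ≤ B`.
    have hne : ∀ i ≤ k, shiftedSquare B i (pos v) ≠ shiftedSquare B i (pos w) →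
        i = i₁ ∨ i = i₂ := by
      intro i hi h
      have hik : i < B := by
        refine lt_of_lt_of_le (lt_of_le_of_ne hi ?_) hkB
        rintro rfl
        exact h (by rw [htop, htop])
      by_contra! hc
      exact h (Prod.ext (not_not.1 fun h' => hc.1 (hi₁ i hik h'))
        (not_not.1 fun h' => hc.2 (hi₂ i hik h')))
    -- Entry `i` involves levels `i` and `i + 1`, so a change at level `i₁` affects only entries
    -- `i₁` and `i₁ - 1`. Repeated or out-of-range indices are harmless: a patch may rewrite an
    -- entry with its own value.
    let z : Fin 4 → ℕ := ![i₁, i₁ - 1, i₂, i₂ - 1]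
    refine Patch.exists_transforms (fun i => (hr i i.2 w).2)
      (fun t => if h : z t < k then ⟨z t, h⟩ else ⟨0, hk⟩) fun i hi => ?_
    suffices ∃ t, z t = i by
      obtain ⟨t, ht⟩ := this
      exact ⟨t, by simp [ht]⟩
    have : shiftedSquare B i (pos v) ≠ shiftedSquare B i (pos w) ∨
        shiftedSquare B (i + 1) (pos v) ≠ shiftedSquare B (i + 1) (pos w) := by
      by_contra! hc
      exact hi (by simp only [a, hc.1, hc.2])
    have hik := i.2
    rcases this with h | h
    · rcases hne i hik.le h with h | h
      · exact ⟨0, h.symm⟩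
      · exact ⟨2, h.symm⟩
    · rcases hne (i + 1) hik h with h | h
      · exact ⟨1, show i₁ - 1 = i by omega⟩
      · exact ⟨3, show i₂ - 1 = i by omega⟩
  have : Nonempty (Fin k) := ⟨⟨0, hk⟩⟩
  choose! π hπ using hpatch
  let N : V → Fin 3 × Fin 3 → V → Prop := fun v d w => G.Adj v w ∧
    (pos w).1 + 1 = (pos v).1 + d.1 ∧ (pos w).2 + 1 = (pos v).2 + d.2
  have hN : ∀ v d w w', N v d w → N v d w' → w = w' := by
    rintro v d w w' ⟨-, h1, h2⟩ ⟨-, h3, h4⟩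
    exact hinj (Prod.ext (by omega) (by omega))
  let ℓ : V → GridLabel k B X := fun v => ((⟨a v, ha v⟩, o v), fun d =>
    if h : ∃ w, N v d w then some (π v h.choose, o h.choose) else none)
  refine ⟨ℓ, fun v w => ⟨?_, fun h => ?_⟩⟩
  · rintro ⟨d, π', o', h1, h2, h3⟩
    by_cases h : ∃ u, N v d u
    · simp only [ℓ, dif_pos h, Option.some.injEq, Prod.mk.injEq] at h1
      obtain ⟨rfl, rfl⟩ := h1
      have hu := h.choose_spec.1
      -- Patched code and offset determine a vertex, so the stored neighbour is `w`.
      rwa [hao _ w ((hπ v _ hu).unique h2) h3] at hu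
    · simp [ℓ, dif_neg h] at h1
  · obtain ⟨h1, h2⟩ := hadj v w h
    let d : Fin 3 × Fin 3 := (⟨(pos w).1 + 1 - (pos v).1, by omega⟩,
      ⟨(pos w).2 + 1 - (pos v).2, by omega⟩)
    have hd : N v d w := ⟨h, by simp only [d]; omega, by simp only [d]; omega⟩
    have hex : ∃ u, N v d u := ⟨w, hd⟩
    have hw : hex.choose = w := hN _ _ _ _ hex.choose_spec hd
    refine ⟨d, π v w, o w, ?_, hπ v w h, rfl⟩
    simp only [ℓ, dif_pos hex, hw]

/-! ### Compressing coordinates -/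

/-- Coordinates in a strong product of paths can be compressed to be less than the number of
vertices. -/
theorem SubgraphOfStrongProductOfPaths.exists_pos {V : Type u} [Fintype V] {G : SimpleGraph V}
    (h : SubgraphOfStrongProductOfPaths V G) :
    ∃ pos : V → ℕ × ℕ, Function.Injective pos ∧
      (∀ v, (pos v).1 < Fintype.card V ∧ (pos v).2 < Fintype.card V) ∧
      ∀ v w, G.Adj v w → ((pos v).1 ≤ (pos w).1 + 1 ∧ (pos w).1 ≤ (pos v).1 + 1) ∧
        ((pos v).2 ≤ (pos w).2 + 1 ∧ (pos w).2 ≤ (pos v).2 + 1) := by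
  classical
  obtain ⟨m, n, ⟨e⟩⟩ := h
  -- The rank among occupied values: closing gaps keeps coordinates distinct and never lengthens a
  -- unit step.
  let R : (V → ℕ) → V → ℕ := fun x v =>
    ((Finset.univ.image x).filter (· < x v)).card
  have hlt : ∀ x v, R x v < Fintype.card V := fun x v => by
    refine lt_of_lt_of_le (Finset.card_lt_card (t := Finset.univ.image x) ?_)
      (Finset.card_image_le.trans_eq Finset.card_univ)
    refine Finset.filter_ssubset.2 ⟨x v, Finset.mem_image_of_mem _ (Finset.mem_univ v), by simp⟩
  have hmono : ∀ x v w, x v < x w → R x v < R x w := fun x v w hvw => by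
    refine Finset.card_lt_card (Finset.ssubset_iff_of_subset ?_ |>.2 ⟨x v, ?_, by simp⟩)
    · exact Finset.monotone_filter_right _ fun y hy => fun h => h.trans hvw
    · simpa using hvw
  have hRinj : ∀ x v w, R x v = R x w → x v = x w := fun x v w h => by
    rcases lt_trichotomy (x v) (x w) with h' | h' | h'
    · exact absurd h (hmono x v w h').ne
    · exact h'
    · exact absurd h (hmono x w v h').ne'
  have hstep : ∀ x v w, x v ≤ x w + 1 → R x v ≤ R x w + 1 := fun x v w h => by
    refine (Finset.card_le_card (t := insert (x w) ((Finset.univ.image x).filter (· < x w)))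
      fun y hy => ?_).trans (Finset.card_insert_le _ _)
    rw [Finset.mem_filter] at hy
    rw [Finset.mem_insert, Finset.mem_filter]
    by_cases hyw : y = x w
    · exact Or.inl hyw
    · exact Or.inr ⟨hy.1, by omega⟩
  have hpath : ∀ {l : ℕ} {i j : Fin l}, i = j ∨ (SimpleGraph.pathGraph l).Adj i j →
      (i : ℕ) ≤ j + 1 ∧ (j : ℕ) ≤ i + 1 := by
    rintro l i j (rfl | h)
    · omega
    · rw [SimpleGraph.pathGraph_adj] at h
      omega
  let x : V → ℕ := fun v => (e v).1
  let y : V → ℕ := fun v => (e v).2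
  refine ⟨fun v => (R x v, R y v), fun v w hvw => ?_, fun v => ⟨hlt x v, hlt y v⟩,
    fun v w hvw => ?_⟩
  · have h1 := hRinj x v w (congrArg Prod.fst hvw)
    have h2 := hRinj y v w (congrArg Prod.snd hvw)
    exact e.injective (Prod.ext (Fin.ext h1) (Fin.ext h2))
  · obtain ⟨-, h1, h2⟩ := e.toHom.map_adj hvw
    have h1 := hpath h1
    have h2 := hpath h2
    exact ⟨⟨hstep x v w h1.1, hstep x w v h1.2⟩, hstep y v w h2.1, hstep y w v h2.2⟩

/-! ### Encoding by bitstrings -/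

/-- Labels in finite types `U m` can be encoded by bitstrings whose length determines `m`. -/
theorem HasAdjacencyLabellingScheme.of_finite {𝓕 : GraphFamily.{u}} (U : ℕ → Type)
    [∀ m, Fintype (U m)] (T : ∀ m, U m → U m → Prop) (size : ℕ → ℕ) (L : ℕ → ℕ)
    (hL : Function.Injective L) (hcard : ∀ n, Fintype.card (U (size n)) ≤ 2 ^ L (size n))
    (hlabel : ∀ (V : Type u) [Fintype V] (G : SimpleGraph V), 𝓕 V G →
      ∃ ℓ : V → U (size (Fintype.card V)), ∀ v w, T _ (ℓ v) (ℓ w) ↔ G.Adj v w) :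
    HasAdjacencyLabellingScheme 𝓕 fun n => L (size n) := by
  classical
  have henc : ∀ m, ∃ enc : U m → List Bool, Fintype.card (U m) ≤ 2 ^ L m →
      Function.Injective enc ∧ ∀ x, (enc x).length = L m := by
    intro m
    by_cases h : Fintype.card (U m) ≤ 2 ^ L m
    · obtain ⟨g⟩ := Function.Embedding.nonempty_of_card_le (α := U m)
        (β := List.Vector Bool (L m)) (by simpa using h)
      exact ⟨fun x => (g x).1, fun _ =>
        ⟨Subtype.val_injective.comp g.injective, fun x => (g x).2⟩⟩
    -- Junk for sizes that do not fit; the tester's cardinality guard excludes them.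
    · exact ⟨fun _ => [], fun h' => absurd h' h⟩
  choose enc henc using henc
  refine ⟨fun l l' => decide (∃ m, Fintype.card (U m) ≤ 2 ^ L m ∧
    ∃ x x', enc m x = l ∧ enc m x' = l' ∧ T m x x'), fun V _ G hG => ?_⟩
  obtain ⟨ℓ, hℓ⟩ := hlabel V G hG
  obtain ⟨hinj, hlen⟩ := henc _ (hcard (Fintype.card V))
  refine ⟨fun v => enc _ (ℓ v), fun v => by rw [hlen], fun v w => ?_⟩
  rw [decide_eq_true_iff, ← hℓ]
  constructor
  · rintro ⟨m, hm, x, x', h1, h2, h3⟩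
    have : L m = L (size (Fintype.card V)) := by
      rw [← (henc m hm).2 x, h1, hlen]
    obtain rfl := hL this
    rwa [← hinj h1, ← hinj h2]
  · exact fun h => ⟨_, hcard _, _, _, rfl, rfl, h⟩

/-! ### Parameters and label length -/

/-- The logarithm of the ratio between the sizes of cells of consecutive levels. -/
def branchingBits (m : ℕ) : ℕ := Nat.sqrt (m * (Nat.log 2 m + 1)) + 1

/-- The number of levels. -/
def levelCount (m : ℕ) : ℕ := m / branchingBits m + 1

theorem branchingBits_pos (m : ℕ) : 0 < branchingBits m := Nat.succ_pos _

theorem monotone_branchingBits : Monotone branchingBits := fun _ _ h =>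
  Nat.succ_le_succ (Nat.sqrt_le_sqrt
    (Nat.mul_le_mul h (Nat.succ_le_succ (Nat.log_mono_right h))))

theorem mul_log_lt_branchingBits_sq (m : ℕ) :
    m * (Nat.log 2 m + 1) < branchingBits m * branchingBits m := Nat.lt_succ_sqrt _

theorem lt_branchingBits_mul_levelCount (m : ℕ) : m < branchingBits m * levelCount m :=
  Nat.lt_mul_div_succ m (branchingBits_pos m)

theorem div_branchingBits_mul_le (m : ℕ) :
    m / branchingBits m * (Nat.log 2 m + 1) ≤ branchingBits m := by
  refine Nat.le_of_mul_le_mul_left (le_trans ?_ (mul_log_lt_branchingBits_sq m).le)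
    (branchingBits_pos m)
  rw [← mul_assoc]
  exact Nat.mul_le_mul_right _ (Nat.mul_div_le _ _)

theorem levelCount_le (m : ℕ) : levelCount m ≤ branchingBits m + 1 :=
  Nat.succ_le_succ ((Nat.le_mul_of_pos_right _ (Nat.succ_pos _)).trans
    (div_branchingBits_mul_le m))

theorem levelCount_le_two_pow (m : ℕ) : levelCount m ≤ 2 ^ branchingBits m :=
  (levelCount_le m).trans Nat.lt_two_pow_self

theorem log_add_one_le_branchingBits {m : ℕ} (hm : 0 < m) :
    Nat.log 2 m + 1 ≤ branchingBits m := by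
  have h1 : Nat.log 2 m + 1 ≤ m := Nat.log_lt_self 2 hm.ne'
  have h2 := mul_log_lt_branchingBits_sq m
  by_contra! h
  nlinarith

theorem card_rankCodes_le {m : ℕ} (hm : 0 < m) :
    (boundedProducts (levelCount m) (2 ^ (m + 2 * levelCount m))).card ≤
      2 ^ (m + 10 * branchingBits m) := by
  have hb := branchingBits_pos m
  have hk := levelCount_le m
  have hkm : levelCount m ≤ m + 1 := Nat.succ_le_succ (Nat.div_le_self _ _)
  have hlog := log_add_one_le_branchingBits hm
  have hdiv := div_branchingBits_mul_le m
  have hlt : m < 2 ^ (Nat.log 2 m + 1) := Nat.lt_pow_succ_log_self one_lt_two m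
  have hbase : m + 2 * levelCount m + 1 ≤ 2 ^ (Nat.log 2 m + 1 + 2) := by
    rw [pow_add _ _ 2]
    omega
  -- With `d = m / b` and `L = log m + 1`, the product `(L + 2) * (d + 1)` expands into terms
  -- controlled by `L * d ≤ b`, `d ≤ b` and `L ≤ b`.
  have hexp : (Nat.log 2 m + 1 + 2) * levelCount m ≤ 4 * branchingBits m + 2 := by
    have : levelCount m = m / branchingBits m + 1 := rfl
    nlinarith
  calc _ ≤ 2 ^ (m + 2 * levelCount m) * (m + 2 * levelCount m + 1) ^ levelCount m :=
        card_boundedProducts_two_pow_le _ _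
    _ ≤ 2 ^ (m + 2 * levelCount m) * (2 ^ (Nat.log 2 m + 1 + 2)) ^ levelCount m :=
        Nat.mul_le_mul_left _ (Nat.pow_le_pow_left hbase _)
    _ ≤ _ := by
        rw [← pow_mul, ← pow_add]
        exact Nat.pow_le_pow_right two_pos (by omega)

theorem add_one_le_two_pow_succ {x e : ℕ} (h : x ≤ 2 ^ e) : x + 1 ≤ 2 ^ (e + 1) := by
  have := Nat.one_le_two_pow (n := e)
  rw [pow_succ]
  omega

theorem card_patch_le {k b : ℕ} (hb : 0 < b) (hk : k ≤ 2 ^ b) :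
    Fintype.card (Option (Patch k ((2 ^ b + 1) * (2 ^ b + 1)) × (Fin (2 ^ b) × Fin (2 ^ b)))) ≤
      2 ^ (27 * b) := by
  have h1 : 2 ^ b + 1 ≤ 2 ^ (b + 1) := add_one_le_two_pow_succ le_rfl
  have h2 : (2 ^ b + 1) * (2 ^ b + 1) + 1 ≤ 2 ^ (5 * b) := by
    refine (add_one_le_two_pow_succ (e := b + 1 + (b + 1)) ?_).trans
      (Nat.pow_le_pow_right two_pos (by omega))
    rw [pow_add _ (b + 1)]
    exact Nat.mul_le_mul h1 h1
  simp only [Fintype.card_option, Fintype.card_prod, Fintype.card_fun, Fintype.card_fin]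
  refine (add_one_le_two_pow_succ (e := (b + 5 * b) * 4 + (b + b)) ?_).trans
    (Nat.pow_le_pow_right two_pos (by omega))
  rw [pow_add _ _ (b + b), pow_mul, pow_add _ b, pow_add _ b b]
  exact Nat.mul_le_mul_right _ (Nat.pow_le_pow_left (Nat.mul_le_mul hk h2) _)

theorem card_gridLabel_le {m : ℕ} (hm : 0 < m) :
    Fintype.card (GridLabel (levelCount m) (2 ^ branchingBits m) (2 ^ (m + 2 * levelCount m))) ≤
      2 ^ (m + 300 * branchingBits m) := by
  set b := branchingBits m with hb
  have h1 := card_rankCodes_le hm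
  have h2 := card_patch_le (branchingBits_pos m) (levelCount_le_two_pow m)
  have h3 : Fintype.card (GridLabel (levelCount m) (2 ^ b) (2 ^ (m + 2 * levelCount m))) =
      (boundedProducts (levelCount m) (2 ^ (m + 2 * levelCount m))).card * (2 ^ b * 2 ^ b) *
      Fintype.card (Option (Patch (levelCount m) ((2 ^ b + 1) * (2 ^ b + 1)) ×
        (Fin (2 ^ b) × Fin (2 ^ b)))) ^ 9 := by
    rw [Fintype.card_prod, Fintype.card_prod, Fintype.card_coe, Fintype.card_fun]
    simp
  rw [h3]
  calc _ ≤ 2 ^ (m + 10 * b) * (2 ^ b * 2 ^ b) * (2 ^ (27 * b)) ^ 9 :=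
        Nat.mul_le_mul (Nat.mul_le_mul_right _ h1) (Nat.pow_le_pow_left h2 _)
    _ ≤ _ := by
        rw [← pow_mul, ← pow_add, ← pow_add, ← pow_add]
        exact Nat.pow_le_pow_right two_pos (by omega)

/-- The length of the labels of the scheme for graphs with less than `2 ^ m` vertices. -/
def labelLength (m : ℕ) : ℕ := m + 300 * branchingBits m

theorem hasAdjacencyLabellingScheme_labelLength :
    HasAdjacencyLabellingScheme SubgraphOfStrongProductOfPaths.{u}
      fun n => (labelLength (Nat.log 2 n + 1) : ℝ) := by
  refine HasAdjacencyLabellingScheme.of_finite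
    (fun m => GridLabel (levelCount m) (2 ^ branchingBits m) (2 ^ (m + 2 * levelCount m)))
    (fun _ => GridLabel.Test) (fun n => Nat.log 2 n + 1) labelLength ?_
    (fun n => card_gridLabel_le (Nat.succ_pos _)) fun V _ G hG => ?_
  · refine StrictMono.injective fun m n h => ?_
    have := monotone_branchingBits h.le
    simp only [labelLength]
    omega
  · obtain ⟨pos, hinj, hlt, hadj⟩ := hG.exists_pos
    set m := Nat.log 2 (Fintype.card V) + 1 with hm
    have hcard : Fintype.card V < 2 ^ m := Nat.lt_pow_succ_log_self one_lt_two _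
    have hk := levelCount_le_two_pow m
    have hX : Fintype.card V * 4 ^ levelCount m ≤ 2 ^ (m + 2 * levelCount m) := by
      rw [pow_add, pow_mul]
      exact Nat.mul_le_mul_right _ hcard.le
    -- The additional factor `B` leaves room for the shift by `k ≤ B` at the top level.
    have hpow : 2 ^ m + 2 ^ branchingBits m ≤
        (2 ^ branchingBits m) ^ (levelCount m + 1) := by
      rw [pow_succ (2 ^ branchingBits m), ← pow_mul]
      have h1 : 2 ^ m ≤ 2 ^ (branchingBits m * levelCount m) :=
        Nat.pow_le_pow_right two_pos (lt_branchingBits_mul_levelCount m).le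
      have h2 : 2 ≤ 2 ^ m := Nat.le_self_pow (Nat.succ_ne_zero _) 2
      have h3 : 2 ≤ 2 ^ branchingBits m := Nat.le_self_pow (branchingBits_pos m).ne' 2
      nlinarith
    refine exists_gridLabel G pos hinj hadj (Nat.succ_pos _) hk hX fun v => ?_
    have := hlt v
    constructor <;> omega

/-! ### Asymptotics -/

theorem labelLength_sub_logb_le {n : ℕ} (hn : 16 ≤ n) :
    0 ≤ (labelLength (Nat.log 2 n + 1) : ℝ) - Real.logb 2 n ∧
    (labelLength (Nat.log 2 n + 1) : ℝ) - Real.logb 2 n ≤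
      1000 * Real.sqrt (Real.logb 2 n * Real.logb 2 (Real.logb 2 n)) := by
  have hn0 : (0 : ℝ) < n := by exact_mod_cast (by omega : 0 < n)
  set x := Real.logb 2 n with hx
  set y := Real.logb 2 x with hy
  set m := Nat.log 2 n + 1 with hm
  have hx4 : 4 ≤ x := by
    rw [hx, Real.le_logb_iff_rpow_le one_lt_two hn0]
    norm_num
    exact_mod_cast hn
  have hy2 : 2 ≤ y := by
    rw [hy, Real.le_logb_iff_rpow_le one_lt_two (by linarith)]
    norm_num
    exact hx4
  have hmx : (m : ℝ) ≤ x + 1 := by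
    rw [hm]
    push_cast
    have := Real.natLog_le_logb n 2
    push_cast at this
    linarith
  have hxm : x ≤ m := by
    rw [hx, Real.logb_le_iff_le_rpow one_lt_two hn0, Real.rpow_natCast]
    exact_mod_cast (Nat.lt_pow_succ_log_self one_lt_two n).le
  have hlog : ((Nat.log 2 m + 1 : ℕ) : ℝ) ≤ 2 * y := by
    have h1 := Real.natLog_le_logb m 2
    have h2 : Real.logb 2 m ≤ Real.logb 2 (2 * x) :=
      Real.logb_le_logb_of_le one_lt_two (by linarith) (by linarith)
    rw [Real.logb_mul two_ne_zero (by linarith), Real.logb_self_eq_one one_lt_two] at h2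
    push_cast at h1 ⊢
    linarith
  set s := Real.sqrt (x * y) with hs
  -- This absorbs the additive constants: the excess is at most `1 + 300 * (2 * s + 1) ≤ 901 * s`.
  have hs1 : 1 ≤ s := Real.one_le_sqrt.2 (by nlinarith)
  have hb : (branchingBits m : ℝ) ≤ 2 * s + 1 := by
    rw [branchingBits, Nat.cast_succ]
    gcongr
    refine Real.nat_sqrt_le_real_sqrt.trans ?_
    rw [Real.sqrt_le_left (by positivity), mul_pow, Real.sq_sqrt (by positivity), Nat.cast_mul]
    calc (m : ℝ) * ((Nat.log 2 m + 1 : ℕ) : ℝ) ≤ (2 * x) * (2 * y) :=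
          mul_le_mul (by linarith) hlog (by positivity) (by linarith)
      _ = _ := by ring
  have hL : (labelLength m : ℝ) = m + 300 * branchingBits m := by
    rw [labelLength]; push_cast; ring
  have hb0 : (0 : ℝ) ≤ branchingBits m := by positivity
  rw [hL]
  constructor <;> linarith

theorem sqrt_mul_logb_isLittleO :
    (fun x : ℝ => Real.sqrt (x * Real.logb 2 x)) =o[atTop] fun x => x := by
  have h1 : Tendsto (fun x : ℝ => Real.logb 2 x / x) atTop (nhds 0) := by
    have := (Real.isLittleO_log_id_atTop.tendsto_div_nhds_zero).div_const (Real.log 2)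
    rw [zero_div] at this
    refine this.congr fun x => ?_
    simp only [Real.logb, id]
    ring
  have h2 := (Real.continuous_sqrt.tendsto 0).comp h1
  rw [Real.sqrt_zero] at h2
  refine (isLittleO_iff_tendsto' ?_).2 (h2.congr' ?_)
  · filter_upwards [eventually_gt_atTop 0] with x hx h
    exact absurd h hx.ne'
  · filter_upwards [eventually_gt_atTop 0] with x hx
    rw [Function.comp_apply, show Real.logb 2 x / x = x * Real.logb 2 x / x ^ 2 by field_simp,
      Real.sqrt_div' _ (sq_nonneg x), Real.sqrt_sq hx.le]

theorem mainTheorem4 :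
    ∃ f : ℕ → ℝ,
      HasAdjacencyLabellingScheme SubgraphOfStrongProductOfPaths.{u} f ∧
      (f ~[atTop] fun n : ℕ => Real.logb 2 n) ∧
      (fun n : ℕ => f n - Real.logb 2 n) =O[atTop]
        fun n : ℕ => Real.sqrt (Real.logb 2 n * Real.logb 2 (Real.logb 2 n)) := by
  have hO : (fun n : ℕ => (labelLength (Nat.log 2 n + 1) : ℝ) - Real.logb 2 n) =O[atTop]
      fun n : ℕ => Real.sqrt (Real.logb 2 n * Real.logb 2 (Real.logb 2 n)) := by
    refine IsBigO.of_bound 1000 ?_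
    filter_upwards [eventually_ge_atTop 16] with n hn
    obtain ⟨h1, h2⟩ := labelLength_sub_logb_le hn
    rwa [Real.norm_of_nonneg h1, Real.norm_of_nonneg (Real.sqrt_nonneg _)]
  refine ⟨_, hasAdjacencyLabellingScheme_labelLength, ?_, hO⟩
  exact hO.trans_isLittleO (sqrt_mul_logb_isLittleO.comp_tendsto
    ((Real.tendsto_logb_atTop one_lt_two).comp tendsto_natCast_atTop_atTop))
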